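/- \textbf{Theorem.} For $x,y\in\{0,1\}^\ell$ let $\mathsf{HAM}^t(x,y)=1$ if the Hamming distance of $x$ and $y$ is at least $t$, and $\mathsf{HAM}^t(x,y)=0$ otherwise. A property-preserving hash (PPH) family on $\ell$-bit strings with hash values in a finite set $Y$ consists of a randomized procedure $\mathsf{Sample}$ that outputs (a description of) a hash function $h$, and deterministic maps $h:\{0,1\}^\ell\to Y$ and $\mathsf{Eval}(h,\cdot,\cdot):Y\times Y\to\{0,1\}$; its output length is $\log_2|Y|$ bits (so $s$ bits if $Y=\{0,1\}^s$). No bound is placed on the running time of these procedures. For every constant $\delta_0<1/2$ there is a constant $c>0$, depending only on $\delta_0$, such that the following holds for all integers $1\le t\le \ell$ and all real $0\le\delta\le\delta_0$. If a PPH family on $\ell$-bit strings satisfies \[ \Pr\bigl[h\leftarrow\mathsf{Sample}:\ \mathsf{Eval}(h,h(x),h(y))\neq \mathsf{HAM}^t(x,y)\bigr]\le\delta \qquad\text{for all fixed } x,y\in\{0,1\}^\ell , \] then its output length is at least \[ c\cdot t\,\log_2\Bigl(\min\Bigl\{\frac{\ell}{t},\frac1\delta\Bigr\}\Bigr) \]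 bits, where $1/0=\infty$. That is, the output length is $\Omega\bigl(t\log(\min\{\ell/t,1/\delta\})\bigr)$. (The hypothesis only concerns inputs chosen independently of $h$, so it is weaker than direct-access robustness with error at most $\delta$.) -/

import Mathlib

/-- The two-input Hamming predicate on `ℓ`-bit strings: `1` iff the Hamming distance is at least
`t`, and `0` otherwise. -/
def HAM (ℓ t : ℕ) (x y : Fin ℓ → Bool) : Bool := decide (t ≤ hammingDist x y)

/-- The data of a (property-preserving) hash function family with inputs in `X` and hash values
in `Y`. `K` is the set of descriptions of hash functions; the randomized algorithm
`sample` is given by its output distribution on `K`, while `hash` and `eval` are deterministic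
and both get the sampled description. No bound on the resources of the three
algorithms is imposed. -/
structure PPH (K X Y : Type*) where
  sample : PMF K
  hash : K → X → Y
  eval : K → Y → Y → Bool

namespace PPH

/-- `Pr[h ← sample : eval(h, h(x), h(y)) ≠ P(x, y)]`, for inputs `x`, `y` fixed before
`h` is sampled. -/
noncomputable def error {K X Y : Type*} (H : PPH K X Y) (P : X → X → Bool) (x y : X) : ENNReal :=
  H.sample.toOuterMeasure {h | H.eval h (H.hash h x) (H.hash h y) ≠ P x y}

/-- The family computes the two-input predicate `P` with success probability at least `1 - δ` on
every pair of non-adaptively chosen inputs. -/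
def HasErrorAtMost {K X Y : Type*} (H : PPH K X Y) (P : X → X → Bool) (δ : ℝ) : Prop :=
  ∀ x y : X, H.error P x y ≤ ENNReal.ofReal δ

/-- The output length in bits, `log₂ |Y|`; it is `s` when `Y` is the set of `s`-bit strings. -/
noncomputable def outputLength {K X Y : Type*} [Fintype Y] (_H : PPH K X Y) : ℝ :=
  Real.logb 2 (Fintype.card Y)

end PPH

/-- `min {ℓ / t, 1 / δ}` for `δ ≥ 0`, where `1 / 0 = ∞`. -/
noncomputable def minRatio (ℓ t : ℕ) (δ : ℝ) : ℝ :=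
  if δ = 0 then (ℓ : ℝ) / t else min ((ℓ : ℝ) / t) (1 / δ)

/-! The proof reduces from one-way indexing. A word of `n` letters over `k` symbols is written as
one-hot blocks, and asking whether its `i`-th letter is `q` becomes a Hamming query against a fixed
probe (`exists_index_encoding`). The hash value is thus a short message from which each letter can
be recovered with small error. After fixing one good description `h`, a rate-distortion count
(`pow_mul_exp_le_card_mul`) shows that few messages cannot approximate all `k ^ n` words.

With `r = minRatio ℓ t δ`, large `r` uses `n = t`, `k = ⌊r / 4⌋₊` and a union bound over `k`
queries, of total error at most `1 / 4`. Bounded `r` uses `k = 2` and a single query per bit, so any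
`δ` bounded away from `1 / 2` suffices. -/

/-! ### Averaging over the sampled description -/

/-- A family of events of probability at most `ε` each: some outcome lies in at most the expected
number of them. -/
theorem PMF.exists_sum_indicator_le {K ι : Type*} [Fintype ι] (p : PMF K) (S : ι → Set K)
    {ε : ℝ} (hε : 0 ≤ ε) (hS : ∀ j, p.toOuterMeasure (S j) ≤ ENNReal.ofReal ε) :
    ∃ h, ∑ j, (S j).indicator (fun _ => (1 : ℝ)) h ≤ Fintype.card ι * ε := by
  classical
  set C : ENNReal := Fintype.card ι * ENNReal.ofReal ε with hC
  have hCtop : C ≠ ⊤ := ENNReal.mul_ne_top (ENNReal.natCast_ne_top _) ENNReal.ofReal_ne_top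
  set N : K → ENNReal := fun h => ∑ j, (S j).indicator (fun _ => (1 : ENNReal)) h with hN
  have hle : ∑' h, p h * N h ≤ C := by
    calc ∑' h, p h * N h = ∑' h, ∑ j, (S j).indicator p h := by
          refine tsum_congr fun h => ?_
          rw [hN, Finset.mul_sum]
          refine Finset.sum_congr rfl fun j _ => ?_
          by_cases hj : h ∈ S j <;> simp [hj]
      _ = ∑ j, ∑' h, (S j).indicator p h :=
          Summable.tsum_finsetSum fun _ _ => ENNReal.summable
      _ ≤ ∑ _j : ι, ENNReal.ofReal ε := by
          refine Finset.sum_le_sum fun j _ => ?_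
          rw [← PMF.toOuterMeasure_apply]
          exact hS j
      _ = C := by simp [hC]
  obtain ⟨h, hh⟩ : ∃ h, N h ≤ C := by
    by_contra! hcon
    obtain ⟨h₀, hh₀⟩ := p.support_nonempty
    have hsum : ∑' h, p h * C = C := by rw [ENNReal.tsum_mul_right, p.tsum_coe, one_mul]
    have hlt : ∑' h, p h * C < ∑' h, p h * N h := by
      refine ENNReal.tsum_lt_tsum (i := h₀) (by rwa [hsum])
        (fun h => mul_le_mul_right (hcon h).le _) ?_
      exact (ENNReal.mul_lt_mul_iff_right ((p.mem_support_iff h₀).1 hh₀) (p.apply_ne_top h₀)).2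
        (hcon h₀)
    rw [hsum] at hlt
    exact absurd hle (not_le.2 hlt)
  refine ⟨h, ?_⟩
  have h1 : N h = ENNReal.ofReal (∑ j, (S j).indicator (fun _ => (1 : ℝ)) h) := by
    rw [ENNReal.ofReal_sum_of_nonneg fun j _ => Set.indicator_nonneg (fun _ _ => zero_le_one) h]
    refine Finset.sum_congr rfl fun j _ => ?_
    by_cases hj : h ∈ S j <;> simp [hj]
  have h2 : C = ENNReal.ofReal (Fintype.card ι * ε) := by
    rw [ENNReal.ofReal_mul (Nat.cast_nonneg _), ENNReal.ofReal_natCast]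
  rw [h1, h2] at hh
  exact (ENNReal.ofReal_le_ofReal_iff (by positivity)).1 hh

/-! ### Counting words close to few centres -/

/-- Jensen's inequality for `v ↦ exp (-s v)` and the uniform distribution. -/
theorem card_mul_exp_le_sum_exp {α : Type*} [Fintype α] (d : α → ℝ) {a s : ℝ} (hs : 0 ≤ s)
    (hd : ∑ x, d x ≤ Fintype.card α * a) :
    Fintype.card α * Real.exp (-s * a) ≤ ∑ x, Real.exp (-s * d x) := by
  -- Tangent line of the exponential at `-s * a`; as `0 ≤ s`, an upper bound on the mean of `d` is
  -- enough.
  have h1 : ∀ x, Real.exp (-s * a) * (1 - s * (d x - a)) ≤ Real.exp (-s * d x) := fun x => by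
    have h2 : -s * d x = -s * a + -s * (d x - a) := by ring
    rw [h2, Real.exp_add]
    refine mul_le_mul_of_nonneg_left ?_ (Real.exp_pos _).le
    linarith [Real.add_one_le_exp (-s * (d x - a))]
  refine le_trans ?_ (Finset.sum_le_sum fun x _ => h1 x)
  rw [← Finset.mul_sum, Finset.sum_sub_distrib, ← Finset.mul_sum, Finset.sum_sub_distrib]
  simp only [Finset.sum_const, Finset.card_univ, nsmul_eq_mul, mul_one]
  nlinarith [Real.exp_pos (-s * a), mul_nonneg (Real.exp_pos (-s * a)).le
    (mul_nonneg hs (sub_nonneg.2 hd))]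

/-- The generating function of the Hamming distances to a fixed word. -/
theorem sum_exp_hammingDist {n k : ℕ} (s : ℝ) (z : Fin n → Fin k) :
    ∑ x : Fin n → Fin k, Real.exp (-s * hammingDist z x) =
      (1 + (k - 1) * Real.exp (-s)) ^ n := by
  have h1 : ∀ i, ∑ a : Fin k, Real.exp (-s * if z i ≠ a then 1 else 0) =
      1 + (k - 1) * Real.exp (-s) := fun i => by
    rw [← Finset.add_sum_erase _ _ (Finset.mem_univ (z i))]
    have h2 : ∀ a ∈ Finset.univ.erase (z i),
        Real.exp (-s * if z i ≠ a then 1 else 0) = Real.exp (-s) := fun a ha => by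
      rw [if_pos (Finset.ne_of_mem_erase ha).symm, mul_one]
    rw [Finset.sum_congr rfl h2, Finset.sum_const, Finset.card_erase_of_mem (Finset.mem_univ _)]
    have hk : 1 ≤ k := Fin.pos (z i)
    simp [Nat.cast_sub hk]
  calc ∑ x : Fin n → Fin k, Real.exp (-s * hammingDist z x)
      = ∑ x : Fin n → Fin k, ∏ i, Real.exp (-s * if z i ≠ x i then 1 else 0) := by
        refine Finset.sum_congr rfl fun x _ => ?_
        rw [← Real.exp_sum, ← Finset.mul_sum, Finset.sum_boole]
        rfl
    _ = ∏ i, ∑ a : Fin k, Real.exp (-s * if z i ≠ a then 1 else 0) := by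
        rw [Finset.prod_univ_sum, Fintype.piFinset_univ]
    _ = _ := by
        rw [Finset.prod_congr rfl fun i _ => h1 i, Finset.prod_const, Finset.card_univ,
          Fintype.card_fin]

/-- If the words of length `n` over `k` letters are approximated, up to relative error `ε` on
average, by the reconstructions from a message in `Y`, then `Y` is large. -/
theorem pow_mul_exp_le_card_mul {Y : Type*} [Fintype Y] {n k : ℕ}
    (f : (Fin n → Fin k) → Y) (z : Y → Fin n → Fin k) {s ε : ℝ} (hs : 0 ≤ s)
    (hd : ∑ x, (hammingDist (z (f x)) x : ℝ) ≤ (k : ℝ) ^ n * (n * ε)) :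
    (k : ℝ) ^ n * Real.exp (-s * (n * ε)) ≤
      Fintype.card Y * (1 + (k - 1) * Real.exp (-s)) ^ n := by
  have hcard : (Fintype.card (Fin n → Fin k) : ℝ) = (k : ℝ) ^ n := by simp
  rw [← hcard] at hd ⊢
  calc _ ≤ ∑ x, Real.exp (-s * hammingDist (z (f x)) x) := card_mul_exp_le_sum_exp _ hs hd
    -- Summing over all messages removes the dependence on `f`, at the cost of the factor
    -- `Fintype.card Y`.
    _ ≤ ∑ x, ∑ y, Real.exp (-s * hammingDist (z y) x) :=
        Finset.sum_le_sum fun x _ => Finset.single_le_sum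
          (f := fun y => Real.exp (-s * hammingDist (z y) x))
          (fun y _ => (Real.exp_pos _).le) (Finset.mem_univ (f x))
    _ = ∑ y, ∑ x, Real.exp (-s * hammingDist (z y) x) := Finset.sum_comm
    _ = _ := by
        rw [Finset.sum_congr rfl fun y _ => sum_exp_hammingDist s (z y), Finset.sum_const,
          Finset.card_univ, nsmul_eq_mul]

/-! ### The indexing problem -/

/-- Lower bound for the large-alphabet indexing problem: if every letter of a word `x` can be
decoded from the hash value of an encoding of `x` with error probability at most `ε`, then the
hash values are long. -/
theorem PPH.log_card_ge_of_decoder {K X Y : Type*} [Fintype Y] (H : PPH K X Y) {n k : ℕ}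
    (hk : 1 ≤ k) (enc : (Fin n → Fin k) → X) (dec : K → Y → Fin n → Fin k) {s ε : ℝ}
    (hs : 0 ≤ s) (hε : 0 ≤ ε)
    (hdec : ∀ x i, H.sample.toOuterMeasure {h | dec h (H.hash h (enc x)) i ≠ x i} ≤
      ENNReal.ofReal ε) :
    n * (Real.log k - s * ε - Real.log (1 + (k - 1) * Real.exp (-s))) ≤
      Real.log (Fintype.card Y) := by
  classical
  obtain ⟨h, hh⟩ := H.sample.exists_sum_indicator_le
    (fun j : (Fin n → Fin k) × Fin n => {h | dec h (H.hash h (enc j.1)) j.2 ≠ j.1 j.2}) hε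
    fun j => hdec j.1 j.2
  have hd : ∑ x, (hammingDist (dec h (H.hash h (enc x))) x : ℝ) ≤ (k : ℝ) ^ n * (n * ε) := by
    have hrw : ∀ x : Fin n → Fin k, (hammingDist (dec h (H.hash h (enc x))) x : ℝ) =
        ∑ i, Set.indicator {h | dec h (H.hash h (enc x)) i ≠ x i} (fun _ => (1 : ℝ)) h :=
      fun x => by
        simp only [Set.indicator_apply, Set.mem_ofPred_eq, Finset.sum_boole]
        rfl
    simp only [hrw]
    rw [Fintype.sum_prod_type] at hh
    refine hh.trans (le_of_eq ?_)
    simp [mul_assoc]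
  have hmain := pow_mul_exp_le_card_mul (fun x => H.hash h (enc x)) (dec h) hs hd
  have hk0 : (0 : ℝ) < k := by exact_mod_cast hk
  have hb : (0 : ℝ) < 1 + (k - 1) * Real.exp (-s) := by
    have : (1 : ℝ) ≤ k := by exact_mod_cast hk
    have := mul_nonneg (sub_nonneg.2 this) (Real.exp_pos (-s)).le
    linarith
  have hY : (0 : ℝ) < Fintype.card Y := by
    have : Nonempty Y := ⟨H.hash h (enc fun _ => ⟨0, hk⟩)⟩
    exact_mod_cast Fintype.card_pos
  have hlog := Real.log_le_log (by positivity) hmain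
  rw [Real.log_mul (by positivity) (by positivity), Real.log_mul hY.ne' (by positivity),
    Real.log_exp, Real.log_pow, Real.log_pow] at hlog
  linarith

/-! ### Indexing through the Hamming predicate -/

/-- The `n` one-hot blocks of length `k` that represent a word, followed by `m` zeros. -/
def oneHot {n k : ℕ} (m : ℕ) (x : Fin n → Fin k) : (Fin n × Fin k) ⊕ Fin m → Bool :=
  Sum.elim (fun p => decide (x p.1 = p.2)) fun _ => false

/-- A single one at position `(i, q)`, followed by `m` ones. -/
def probe {n k : ℕ} (m : ℕ) (i : Fin n) (q : Fin k) : (Fin n × Fin k) ⊕ Fin m → Bool :=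
  Sum.elim (fun p => decide (p = (i, q))) fun _ => true

/-- For `m = t - n` the two values are `t - 1` and `t + 1`, on opposite sides of the threshold. -/
theorem hammingDist_oneHot_probe {n k : ℕ} (m : ℕ) (x : Fin n → Fin k) (i : Fin n) (q : Fin k) :
    hammingDist (oneHot m x) (probe m i q) = n - 1 + (if x i = q then 0 else 2) + m := by
  have hblock : ∀ j : Fin n,
      (∑ a : Fin k, if decide (x j = a) ≠ decide ((j, a) = (i, q)) then 1 else 0) =
        if j = i then (if x i = q then 0 else 2) else 1 := fun j => by
    by_cases hj : j = i
    · subst hj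
      rw [if_pos rfl, ← Finset.card_filter]
      split_ifs with hq
      · simp [hq, eq_comm]
      · rw [← Finset.card_pair hq]
        congr 1
        ext a
        simp only [ne_eq, Prod.mk.injEq, true_and, decide_eq_decide, Finset.mem_filter,
          Finset.mem_univ, Finset.mem_insert, Finset.mem_singleton]
        grind
    · simp [hj]
  have hsum : hammingDist (oneHot m x) (probe m i q) =
      (∑ j : Fin n, ∑ a : Fin k,
        if decide (x j = a) ≠ decide ((j, a) = (i, q)) then 1 else 0) + m := by
    unfold hammingDist
    rw [Finset.card_filter, Fintype.sum_sum_type, Fintype.sum_prod_type]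
    simp [oneHot, probe]
  rw [hsum]
  simp only [hblock]
  rw [← Finset.add_sum_erase _ _ (Finset.mem_univ i), if_pos rfl,
    Finset.sum_congr rfl fun j hj => if_neg (Finset.ne_of_mem_erase hj)]
  simp [add_comm]

theorem hammingDist_extend {ι κ : Type*} [Fintype ι] [Fintype κ] (e : ι ↪ κ)
    (f g : ι → Bool) (c : κ → Bool) :
    hammingDist (Function.extend e f c) (Function.extend e g c) = hammingDist f g := by
  classical
  unfold hammingDist
  rw [← Finset.card_map e]
  congr 1
  ext j
  simp only [Finset.mem_filter, Finset.mem_univ, true_and, Finset.mem_map]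
  constructor
  · intro h
    by_cases hj : ∃ a, e a = j
    · obtain ⟨a, rfl⟩ := hj
      exact ⟨a, by simpa [e.injective.extend_apply] using h, rfl⟩
    · simp [Function.extend_apply' _ _ _ hj] at h
  · rintro ⟨a, ha, rfl⟩
    simpa [e.injective.extend_apply] using ha

/-- Words of length `n` over `k` letters embed into bit strings so that testing one letter is an
instance of the Hamming predicate. -/
theorem exists_index_encoding {ℓ t n k : ℕ} (hnt : n ≤ t) (hℓ : n * k + (t - n) ≤ ℓ) :
    ∃ (enc : (Fin n → Fin k) → Fin ℓ → Bool) (test : Fin n → Fin k → Fin ℓ → Bool),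
      ∀ x i q, HAM ℓ t (enc x) (test i q) = decide (x i ≠ q) := by
  obtain ⟨e⟩ : Nonempty ((Fin n × Fin k) ⊕ Fin (t - n) ↪ Fin ℓ) :=
    Function.Embedding.nonempty_of_card_le (by simpa using hℓ)
  refine ⟨fun x => Function.extend e (oneHot _ x) fun _ => false,
    fun i q => Function.extend e (probe _ i q) fun _ => false, fun x i q => ?_⟩
  have hn : 0 < n := Fin.pos i
  rw [HAM, hammingDist_extend, hammingDist_oneHot_probe, decide_eq_decide]
  split_ifs with h
  · simp only [h, ne_eq, not_true_eq_false, iff_false]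
    omega
  · simp only [h, ne_eq, not_false_eq_true, iff_true]
    omega

/-- Letters from a `k`-letter alphabet are decoded with `k` queries. -/
theorem PPH.log_card_ge_of_alphabet {K Y : Type*} [Fintype Y] {ℓ t n k : ℕ} {δ : ℝ}
    (H : PPH K (Fin ℓ → Bool) Y) (hH : H.HasErrorAtMost (HAM ℓ t) δ) (hδ : 0 ≤ δ) (hk : 1 ≤ k)
    (hnt : n ≤ t) (hℓ : n * k + (t - n) ≤ ℓ) {s : ℝ} (hs : 0 ≤ s) :
    n * (Real.log k - s * (k * δ) - Real.log (1 + (k - 1) * Real.exp (-s))) ≤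
      Real.log (Fintype.card Y) := by
  classical
  obtain ⟨enc, test, henc⟩ := exists_index_encoding (k := k) hnt hℓ
  -- If all `k` answers are correct, only the true letter answers `false`. The default letter is
  -- used only when some answer is wrong.
  let dec : K → Y → Fin n → Fin k := fun h y i =>
    if hq : ∃ q, H.eval h y (H.hash h (test i q)) = false then hq.choose else ⟨0, hk⟩
  refine H.log_card_ge_of_decoder hk enc dec hs (by positivity) fun x i => ?_
  have hsub : {h | dec h (H.hash h (enc x)) i ≠ x i} ⊆
      ⋃ q, {h | H.eval h (H.hash h (enc x)) (H.hash h (test i q)) ≠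
        HAM ℓ t (enc x) (test i q)} := by
    intro h hh
    by_contra hcon
    simp only [Set.mem_iUnion, Set.mem_ofPred_eq, not_exists, not_not, henc] at hcon
    have hq : ∃ q, H.eval h (H.hash h (enc x)) (H.hash h (test i q)) = false :=
      ⟨x i, by simp [hcon]⟩
    have hspec := hq.choose_spec
    rw [hcon, decide_eq_false_iff_not, not_not] at hspec
    exact hh (by simp only [dec]; rw [dif_pos hq, ← hspec])
  calc _ ≤ ∑' q, H.error (HAM ℓ t) (enc x) (test i q) :=
        (MeasureTheory.measure_mono hsub).trans (MeasureTheory.measure_iUnion_le _)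
    _ ≤ ∑' _q : Fin k, ENNReal.ofReal δ := ENNReal.tsum_le_tsum fun q => hH _ _
    _ = _ := by
        rw [tsum_fintype, ENNReal.ofReal_mul (Nat.cast_nonneg _), ENNReal.ofReal_natCast]
        simp

/-- Bits are decoded with one query. -/
theorem PPH.log_card_ge_of_bits {K Y : Type*} [Fintype Y] {ℓ t n : ℕ} {δ : ℝ}
    (H : PPH K (Fin ℓ → Bool) Y) (hH : H.HasErrorAtMost (HAM ℓ t) δ) (hδ : 0 ≤ δ)
    (hnt : n ≤ t) (hℓ : n + t ≤ ℓ) {s : ℝ} (hs : 0 ≤ s) :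
    n * (Real.log 2 - s * δ - Real.log (1 + Real.exp (-s))) ≤ Real.log (Fintype.card Y) := by
  obtain ⟨enc, test, henc⟩ := exists_index_encoding (ℓ := ℓ) (k := 2) hnt (by omega)
  have h := H.log_card_ge_of_decoder (n := n) one_le_two enc
    (fun h y i => if H.eval h y (H.hash h (test i 0)) = true then 1 else 0) hs hδ fun x i => by
      refine (MeasureTheory.measure_mono fun h hh => ?_).trans (hH (enc x) (test i 0))
      simp only [Set.mem_ofPred_eq, henc] at hh ⊢
      intro hcon
      apply hh
      rw [hcon]
      have h01 : x i = 0 ∨ x i = 1 := by omega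
      rcases h01 with h0 | h1
      · simp [h0]
      · simp [h1]
  norm_num at h ⊢
  exact h

/-! ### Numerical estimates -/

/-- For error `1 / 2 - g` and `s = 4 * g`, factoring out `exp (-2g)` turns the right side into `4g²
- log cosh (2g)`, and `log cosh u ≤ u² / 2`. -/
theorem two_mul_sq_le_log_two_sub {g : ℝ} :
    2 * g ^ 2 ≤ Real.log 2 - 4 * g * (1 / 2 - g) - Real.log (1 + Real.exp (-(4 * g))) := by
  have h1 : 1 + Real.exp (-(4 * g)) = 2 * (Real.exp (-(2 * g)) * Real.cosh (2 * g)) := by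
    rw [Real.cosh_eq, mul_div_assoc', mul_add, ← Real.exp_add, ← Real.exp_add]
    ring_nf
    simp
    ring
  have h2 := Real.log_le_log (Real.cosh_pos _) (Real.cosh_le_exp_half_sq (2 * g))
  rw [Real.log_exp] at h2
  rw [h1, Real.log_mul two_ne_zero (by positivity),
    Real.log_mul (Real.exp_pos _).ne' (Real.cosh_pos _).ne', Real.log_exp]
  linarith

/-- At `s = log k` the last logarithm is at most `log 2`. The threshold `64` gives `k ≥ 16`, so `log
2 ≤ log k / 4` and `r ≤ k²`; what remains is `log k / 2 ≥ log r / 4`. -/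
theorem quarter_mul_log_le {r δ : ℝ} (hr : 64 ≤ r) (hδr : r * δ ≤ 1) :
    Real.log r / 4 ≤ Real.log (⌊r / 4⌋₊ : ℝ) - Real.log (⌊r / 4⌋₊ : ℝ) * (⌊r / 4⌋₊ * δ) -
      Real.log (1 + ((⌊r / 4⌋₊ : ℝ) - 1) * Real.exp (-Real.log (⌊r / 4⌋₊ : ℝ))) := by
  set k : ℝ := (⌊r / 4⌋₊ : ℝ) with hk
  have hk1 : k ≤ r / 4 := Nat.floor_le (by linarith)
  have hk2 : r / 4 - 1 < k := Nat.sub_one_lt_floor _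
  have hk16 : (16 : ℝ) ≤ k := by
    have : 16 ≤ ⌊r / 4⌋₊ := Nat.le_floor (by norm_num; linarith)
    rw [hk]
    exact_mod_cast this
  have hk0 : 0 < k := by linarith
  have hδ : k * δ ≤ 1 / 4 := by
    rcases le_total 0 δ with h | h
    · nlinarith [mul_le_mul_of_nonneg_right hk1 h]
    · nlinarith [mul_nonpos_of_nonneg_of_nonpos hk0.le h]
  have hlog16 : 4 * Real.log 2 ≤ Real.log k := by
    rw [← Real.log_rpow two_pos]
    exact Real.log_le_log (by positivity) (by norm_num; linarith)
  have hlogr : Real.log r ≤ 2 * Real.log k := by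
    rw [← Real.log_rpow hk0]
    refine Real.log_le_log (by linarith) ?_
    norm_num
    nlinarith
  have hlog2 : Real.log (1 + (k - 1) * Real.exp (-Real.log k)) ≤ Real.log 2 := by
    rw [Real.exp_neg, Real.exp_log hk0]
    have h1 : (k - 1) * k⁻¹ = 1 - k⁻¹ := by field_simp
    have h2 : k⁻¹ ≤ 1 := inv_le_one_of_one_le₀ (by linarith)
    have h3 : 0 < k⁻¹ := by positivity
    rw [h1]
    exact Real.log_le_log (by linarith) (by linarith)
  have hlogk : 0 ≤ Real.log k := Real.log_nonneg (by linarith)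
  nlinarith [mul_le_mul_of_nonneg_left hδ hlogk]

theorem minRatio_le_div (ℓ t : ℕ) (δ : ℝ) : minRatio ℓ t δ ≤ (ℓ : ℝ) / t := by
  unfold minRatio
  split_ifs
  · exact le_rfl
  · exact min_le_left _ _

theorem minRatio_mul_le_one {ℓ t : ℕ} {δ : ℝ} (hδ : 0 ≤ δ) : minRatio ℓ t δ * δ ≤ 1 := by
  unfold minRatio
  split_ifs with h
  · simp [h]
  · have hpos : 0 < δ := lt_of_le_of_ne hδ (Ne.symm h)
    rw [← le_div_iff₀ hpos]
    exact min_le_right _ _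

theorem minRatio_pos {ℓ t : ℕ} {δ : ℝ} (ht : 1 ≤ t) (htℓ : t ≤ ℓ) (hδ : 0 ≤ δ) :
    0 < minRatio ℓ t δ := by
  have ht0 : (0 : ℝ) < t := by exact_mod_cast ht
  have hℓ0 : (0 : ℝ) < ℓ := by exact_mod_cast ht.trans htℓ
  unfold minRatio
  split_ifs with h
  · positivity
  · have hpos : 0 < δ := lt_of_le_of_ne hδ (Ne.symm h)
    exact lt_min (by positivity) (by positivity)

/-- Small ratios: `t log (ℓ / t)` is of the order of `min {t, ℓ - t}`. -/
theorem mul_log_minRatio_le {ℓ t : ℕ} {δ : ℝ} (ht : 1 ≤ t) (htℓ : t ≤ ℓ) (hδ : 0 ≤ δ)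
    (hr : minRatio ℓ t δ ≤ 64) :
    t * Real.log (minRatio ℓ t δ) ≤ (min t (ℓ - t) : ℕ) * Real.log 64 := by
  have ht0 : (0 : ℝ) < t := by exact_mod_cast ht
  have hr0 := minRatio_pos ht htℓ hδ
  have h64 : 1 ≤ Real.log 64 := by
    rw [Real.le_log_iff_exp_le (by norm_num)]
    linarith [Real.exp_one_lt_d9]
  rcases le_total t (ℓ - t) with h | h
  · rw [min_eq_left h]
    exact mul_le_mul_of_nonneg_left (Real.log_le_log hr0 hr) ht0.le
  · rw [min_eq_right h, Nat.cast_sub htℓ]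
    have hdiff : (0 : ℝ) ≤ ℓ - t := sub_nonneg.2 (by exact_mod_cast htℓ)
    have h1 : Real.log (minRatio ℓ t δ) ≤ (ℓ : ℝ) / t - 1 :=
      (Real.log_le_sub_one_of_pos hr0).trans (by linarith [minRatio_le_div ℓ t δ])
    calc t * Real.log (minRatio ℓ t δ) ≤ t * ((ℓ : ℝ) / t - 1) :=
          mul_le_mul_of_nonneg_left h1 ht0.le
      _ = (ℓ - t : ℝ) := by field_simp
      _ ≤ _ := le_mul_of_one_le_right hdiff h64

/-! ### The lower bound -/

theorem mainTheorem4 (δ₀ : ℝ) (hδ₀ : δ₀ < 1 / 2) :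
    ∃ c : ℝ, 0 < c ∧
      ∀ (ℓ t : ℕ) (δ : ℝ), 1 ≤ t → t ≤ ℓ → 0 ≤ δ → δ ≤ δ₀ →
        ∀ (K Y : Type*) [Fintype Y] (H : PPH K (Fin ℓ → Bool) Y),
          H.HasErrorAtMost (HAM ℓ t) δ →
            c * (t * Real.logb 2 (minRatio ℓ t δ)) ≤ H.outputLength := by
  set g : ℝ := 1 / 2 - δ₀ with hg
  have hg0 : 0 < g := by linarith
  have h64 : 0 < Real.log 64 := Real.log_pos (by norm_num)
  -- The two constants come from the regimes `64 ≤ r` and `r ≤ 64` respectively.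
  refine ⟨min (1 / 4) (2 * g ^ 2 / Real.log 64), by positivity, ?_⟩
  intro ℓ t δ ht htℓ hδ hδδ₀ K Y _ H hH
  have ht0 : (0 : ℝ) < t := by exact_mod_cast ht
  set r := minRatio ℓ t δ with hr
  suffices h : min (1 / 4) (2 * g ^ 2 / Real.log 64) * (t * Real.log r) ≤
      Real.log (Fintype.card Y) by
    unfold PPH.outputLength Real.logb
    rw [mul_div_assoc', mul_div_assoc']
    exact div_le_div_of_nonneg_right h (Real.log_nonneg one_le_two)
  have hcard : 0 ≤ Real.log (Fintype.card Y) := Real.log_natCast_nonneg _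
  rcases le_total (t * Real.log r) 0 with hneg | hnonneg
  · exact (mul_nonpos_of_nonneg_of_nonpos (by positivity) hneg).trans hcard
  rcases le_total r 64 with hsmall | hlarge
  -- `min t (ℓ - t)` is the largest number of two-letter blocks that fits: `n ≤ t` and `n + t ≤ ℓ`.
  · have hn : (min t (ℓ - t) : ℕ) * (2 * g ^ 2) ≤ Real.log (Fintype.card Y) := by
      refine le_trans (mul_le_mul_of_nonneg_left ?_ (Nat.cast_nonneg _))
        (H.log_card_ge_of_bits hH hδ (min_le_left t (ℓ - t)) (by omega)
          (s := 4 * g) (by positivity))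
      have h1 := two_mul_sq_le_log_two_sub (g := g)
      have h2 : 4 * g * δ ≤ 4 * g * (1 / 2 - g) :=
        mul_le_mul_of_nonneg_left (by linarith) (by positivity)
      linarith
    calc _ ≤ 2 * g ^ 2 / Real.log 64 * (t * Real.log r) :=
          mul_le_mul_of_nonneg_right (min_le_right _ _) hnonneg
      _ ≤ 2 * g ^ 2 / Real.log 64 * ((min t (ℓ - t) : ℕ) * Real.log 64) :=
          mul_le_mul_of_nonneg_left (mul_log_minRatio_le ht htℓ hδ hsmall) (by positivity)
      _ = (min t (ℓ - t) : ℕ) * (2 * g ^ 2) := by field_simp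
      _ ≤ _ := hn
  · have hk1 : (⌊r / 4⌋₊ : ℝ) ≤ r := (Nat.floor_le (by linarith)).trans (by linarith)
    have htk : t * ⌊r / 4⌋₊ ≤ ℓ := by
      have h1 : (⌊r / 4⌋₊ : ℝ) ≤ (ℓ : ℝ) / t := hk1.trans (minRatio_le_div ℓ t δ)
      rw [le_div_iff₀ ht0, mul_comm] at h1
      exact_mod_cast h1
    have hkpos : 1 ≤ ⌊r / 4⌋₊ := Nat.le_floor (by norm_num; linarith)
    have hk1' : (1 : ℝ) ≤ ⌊r / 4⌋₊ := by exact_mod_cast hkpos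
    calc _ ≤ 1 / 4 * (t * Real.log r) :=
          mul_le_mul_of_nonneg_right (min_le_left _ _) hnonneg
      _ = t * (Real.log r / 4) := by ring
      _ ≤ _ := mul_le_mul_of_nonneg_left
          (quarter_mul_log_le hlarge (minRatio_mul_le_one hδ)) ht0.le
      _ ≤ _ := H.log_card_ge_of_alphabet hH hδ hkpos le_rfl (by simpa using htk)
          (Real.log_nonneg hk1')
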